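/- For a real number $\beta>1$ let $F_\beta:[-1,1]\to[-1,1]$, $F_\beta(x)=\cos(\beta\arccos x)$, be the generalized Chebyshev map. By a Galois conjugate of an algebraic number $\beta$ we mean a complex root, different from $\beta$ itself, of the minimal polynomial of $\beta$ over $\mathbb{Q}$ (a transcendental number has no Galois conjugates). Let $\mathbb{D}$ be the open unit disk in $\mathbb{C}$, let $$\mathcal{G}_{[-1,1]}=\Bigl\{z\in\mathbb{D}\ :\ 1+\sum_{n=1}^\infty a_nz^n=0\ \text{ for some real numbers } a_1,a_2,\ldots\in[-1,1]\Bigr\},$$ and let $\mathcal{G}_{[-1,1]}^{-1}=\{z^{-1} : z\in\mathcal{G}_{[-1,1]}\}$ (note that $0\notin\mathcal{G}_{[-1,1]}$). Then the closure in $\mathbb{C}$ of the set of all Galois conjugates of those real numbers $\beta>1$ for which the forward orbit $\{F_\beta^n(-1) : n\ge 0\}$ is a finite set is equal to $$\operatorname{clos}(\mathbb{D})\cup\mathcal{G}_{[-1,1]}^{-1}.$$ -/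

import Mathlib

open scoped Pointwise

/-- The generalized Chebyshev map `F_β(x) = cos(β arccos x)`. It maps `[-1,1]` into itself; only
its values on `[-1,1]` matter, as the orbits considered start in `[-1,1]`. -/
noncomputable def genChebyshev (β x : ℝ) : ℝ := Real.cos (β * Real.arccos x)

/-- The forward orbit `{f^n(x) ; n ≥ 0}`. -/
def forwardOrbit {X : Type*} (f : X → X) (x : X) : Set X := Set.range fun n : ℕ => f^[n] x

/-- The Galois conjugates of a real number `β`: the complex roots of its minimal polynomial
over `ℚ` other than `β` itself (there are none when `β` is transcendental, because
`rootSet` of the zero polynomial is empty). -/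
noncomputable def galoisConjugates (β : ℝ) : Set ℂ := (minpoly ℚ β).rootSet ℂ \ {(β : ℂ)}

/-- Coefficient sequences of the power series `1 + ∑_{n ≥ 1} a_n z^n` with `a_n ∈ I`
for all `n ≥ 1`. -/
def coeffFamily (I : Set ℝ) : Set (ℕ → ℝ) := {a | a 0 = 1 ∧ ∀ n, 1 ≤ n → a n ∈ I}

/-- The set `𝒢_I` of zeros in the open unit disk of the power series
`1 + ∑_{n ≥ 1} a_n z^n` with `a_n ∈ I` for all `n ≥ 1`. -/
def zeroSet (I : Set ℝ) : Set ℂ :=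
  {z | z ∈ Metric.ball (0 : ℂ) 1 ∧
    ∃ a ∈ coeffFamily I, HasSum (fun n : ℕ => (a n : ℂ) * z ^ n) 0}

/-! Writing points as cos(πu) turns the map into u ↦ βu − 2k, so the lifted orbit of −1 is u_n =
P_n(β), where P_n is a monic integer polynomial with even lower coefficients and |u_n| ≤ 1.

Upper bound: if the orbit is finite, u takes finitely many values, so the conjugate sequence P_n(z)
does too and is bounded. For |z| > 1 a telescoping identity then gives ∑ u_n z^(-n) = 0
(`inv_mem_zeroSet_of_mem_galoisConjugates`). The right-hand side is closed by compactness of the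
coefficient space.

Lower bound: let z be a root of a monic real polynomial A whose other coefficients are at most 1 − δ
in absolute value. For large B, round (x − B)A(x) to an integer polynomial with lower coefficients ≡
2 mod 4. It is irreducible by Eisenstein, has a real root β near B and another root near z, and its
Horner values at β follow the coefficients of A, hence lift a finite orbit
(`smallCoeffRoots_subset`). Such z fill the disk and are dense in the inverse zero set. -/

open Filter Topology Polynomial

/-! ### Horner polynomials -/

/-- The `n`-th value of Horner's scheme: `horner c x n = ∑_{j ≤ n} c_j x^(n-j)`. -/
def horner {R : Type*} [CommRing R] (c : ℕ → R) (x : R) : ℕ → R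
  | 0 => c 0
  | n + 1 => x * horner c x n + c (n + 1)

theorem horner_zero {R : Type*} [CommRing R] (c : ℕ → R) (x : R) : horner c x 0 = c 0 := rfl

theorem horner_succ {R : Type*} [CommRing R] (c : ℕ → R) (x : R) (n : ℕ) :
    horner c x (n + 1) = x * horner c x n + c (n + 1) := rfl

theorem map_horner {R S : Type*} [CommRing R] [CommRing S] (f : R →+* S) (c : ℕ → R) (x : R)
    (n : ℕ) : f (horner c x n) = horner (fun i => f (c i)) (f x) n := by
  induction n with
  | zero => rfl
  | succ n ih => simp [horner_succ, ih]

/-- The monic polynomial with coefficients `c 0, …, c n`, leading coefficient first. -/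
noncomputable def hornerPoly (c : ℕ → ℤ) (n : ℕ) : ℤ[X] := horner (fun i => C (c i)) X n

theorem aeval_hornerPoly {A : Type*} [CommRing A] (c : ℕ → ℤ) (x : A) (n : ℕ) :
    aeval x (hornerPoly c n) = horner (fun i => (c i : A)) x n := by
  have h := map_horner (aeval (R := ℤ) x).toRingHom (fun i => C (c i)) X n
  simpa [hornerPoly] using h

/-! ### Lifting the orbit of −1 through u ↦ cos(πu) -/

theorem genChebyshev_cos {β u v : ℝ} (k : ℤ) (hu : |u| ≤ 1) (hv : v = β * u - 2 * k) :
    genChebyshev β (Real.cos (Real.pi * u)) = Real.cos (Real.pi * v) := by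
  have hpi := Real.pi_pos
  have h1 : Real.cos (Real.pi * u) = Real.cos (Real.pi * |u|) := by
    rw [← Real.cos_abs (Real.pi * u), abs_mul, abs_of_pos hpi]
  have h2 : Real.arccos (Real.cos (Real.pi * |u|)) = Real.pi * |u| :=
    Real.arccos_cos (by positivity) (by nlinarith)
  rw [genChebyshev, h1, h2, ← Real.cos_abs, abs_mul, abs_mul, abs_abs, ← abs_mul, ← abs_mul,
    Real.cos_abs, hv]
  have h3 : Real.pi * (β * u - 2 * k) = β * (Real.pi * u) - k * (2 * Real.pi) := by ring
  rw [h3, Real.cos_sub_int_mul_two_pi]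

theorem iterate_genChebyshev {β : ℝ} {u : ℕ → ℝ} {k : ℕ → ℤ} {N : ℕ} (h0 : u 0 = 1)
    (hu : ∀ n < N, |u n| ≤ 1) (hstep : ∀ n < N, u (n + 1) = β * u n - 2 * k n) :
    ∀ n ≤ N, (genChebyshev β)^[n] (-1) = Real.cos (Real.pi * u n) := by
  intro n hn
  induction n with
  | zero => simp [h0]
  | succ n ih =>
    rw [Function.iterate_succ_apply', ih (by omega), genChebyshev_cos (k n) (hu n (by omega))
      (hstep n (by omega))]

/-- A lift of the orbit of `-1` under `genChebyshev β`, together with its integer digits. -/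
theorem exists_orbit_lift (β : ℝ) :
    ∃ (u : ℕ → ℝ) (k : ℕ → ℤ), u 0 = 1 ∧ (∀ n, |u n| ≤ 1) ∧
      ∀ n, u (n + 1) = β * u n - 2 * k n := by
  let u : ℕ → ℝ := fun n => Nat.rec 1 (fun _ v => β * v - 2 * (round (β * v / 2) : ℤ)) n
  refine ⟨u, fun n => round (β * u n / 2), rfl, fun n => ?_, fun n => rfl⟩
  cases n with
  | zero => simp [u]
  | succ n =>
    have h : u (n + 1) = β * u n - 2 * (round (β * u n / 2) : ℤ) := rfl
    have h2 := abs_sub_round (β * u n / 2)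
    rw [h]
    rw [abs_le] at h2 ⊢
    constructor <;> linarith [h2.1, h2.2]

/-- On [−1, 1] the value cos(πu) determines |u|, so each orbit point has at most two lifts. -/
theorem finite_range_of_finite_cos {u : ℕ → ℝ} (hu : ∀ n, |u n| ≤ 1)
    (h : (Set.range fun n => Real.cos (Real.pi * u n)).Finite) : (Set.range u).Finite := by
  have hpi := Real.pi_pos
  refine ((h.image fun x => Real.arccos x / Real.pi).union
    (h.image fun x => -(Real.arccos x / Real.pi))).subset ?_
  rintro _ ⟨n, rfl⟩
  have h2 : Real.arccos (Real.cos (Real.pi * u n)) / Real.pi = |u n| := by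
    rw [← Real.cos_abs, abs_mul, abs_of_pos hpi,
      Real.arccos_cos (by positivity) (by nlinarith [hu n])]
    field_simp
  rcases abs_choice (u n) with h3 | h3
  · exact Or.inl ⟨_, ⟨n, rfl⟩, by simp only [h2, h3]⟩
  · exact Or.inr ⟨_, ⟨n, rfl⟩, by simp only [h2, h3, neg_neg]⟩

/-! ### Conjugates outside the unit disk -/

theorem aeval_eq_of_mem_galoisConjugates {β : ℝ} {z : ℂ} (hz : z ∈ galoisConjugates β)
    {p q : ℤ[X]} (h : aeval β p = aeval β q) : aeval z p = aeval z q := by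
  have h1 : aeval β ((p - q).map (algebraMap ℤ ℚ)) = 0 := by
    rw [aeval_map_algebraMap, map_sub, h, sub_self]
  have hz0 : aeval z (minpoly ℚ β) = 0 := (mem_rootSet.1 hz.1).2
  have h2 := aeval_eq_zero_of_dvd_aeval_eq_zero (minpoly.dvd ℚ β h1) hz0
  rw [aeval_map_algebraMap, map_sub] at h2
  exact sub_eq_zero.1 h2

theorem inv_mem_zeroSet_of_mem_galoisConjugates {β : ℝ}
    (hfin : (forwardOrbit (genChebyshev β) (-1)).Finite) {z : ℂ} (hz : z ∈ galoisConjugates β)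
    (hz1 : 1 < ‖z‖) : z⁻¹ ∈ zeroSet (Set.Icc (-1) 1) := by
  obtain ⟨u, k, hu0, hu, hstep⟩ := exists_orbit_lift β
  have horb : ∀ n, (genChebyshev β)^[n] (-1) = Real.cos (Real.pi * u n) := fun n =>
    iterate_genChebyshev (N := n) hu0 (fun m _ => hu m) (fun m _ => hstep m) n le_rfl
  have hrange : (Set.range u).Finite := by
    apply finite_range_of_finite_cos hu
    simpa only [forwardOrbit, horb] using hfin
  let c : ℕ → ℤ := fun n => Nat.casesOn n 1 fun m => -(2 * k m)
  let v : ℕ → ℂ := fun n => aeval z (hornerPoly c n)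
  have hur : ∀ n, aeval β (hornerPoly c n) = u n := by
    intro n
    rw [aeval_hornerPoly]
    induction n with
    | zero => simp [horner, c, hu0]
    | succ n ih => rw [horner_succ, ih, hstep]; simp [c]; ring
  have hv0 : v 0 = 1 := by simp [v, aeval_hornerPoly, horner, c]
  have hvs : ∀ n, v (n + 1) = z * v n - 2 * k n := by
    intro n
    simp only [v, aeval_hornerPoly, horner_succ, c]
    push_cast
    ring
  -- A coincidence u n = u m is an integer polynomial relation for β, hence also holds for its
  -- conjugate z.
  have hvfac : ∀ n m, u n = u m → v n = v m := fun n m h =>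
    aeval_eq_of_mem_galoisConjugates hz (by rw [hur, hur, h])
  have hvfin : (Set.range v).Finite := by
    have hd : ∀ x ∈ Set.range u, ∃ y, ∀ n, u n = x → v n = y := by
      rintro _ ⟨m, rfl⟩
      exact ⟨v m, fun n h => hvfac n m h⟩
    choose! g hg using hd
    refine (hrange.image g).subset ?_
    rintro _ ⟨n, rfl⟩
    exact ⟨u n, ⟨n, rfl⟩, (hg (u n) ⟨n, rfl⟩ n rfl).symm⟩
  obtain ⟨M, hM⟩ := hvfin.isBounded.exists_norm_le
  have hM' : ∀ n, ‖v n‖ ≤ M := fun n => hM _ ⟨n, rfl⟩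
  have hzne : z ≠ 0 := by rintro rfl; simp at hz1; linarith
  have hw : ‖z⁻¹‖ < 1 := by rw [norm_inv]; exact inv_lt_one_of_one_lt₀ hz1
  -- The telescoped sum is divided by β − z, which is why β itself must not count as a conjugate.
  have hβz : (β : ℂ) - z ≠ 0 := by
    intro h
    exact hz.2 (sub_eq_zero.1 h).symm
  -- Both sequences have the same digits `k`, so these cancel in u − v and the sum telescopes.
  have hsum : ∀ N, ((β : ℂ) - z) * ∑ n ∈ Finset.range N, (u n : ℂ) * z⁻¹ ^ n =
      z * (z⁻¹ ^ N * (u N - v N)) := by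
    intro N
    induction N with
    | zero => simp [hu0, hv0]
    | succ N ih =>
      rw [Finset.sum_range_succ, mul_add, ih, hvs, hstep, pow_succ]
      push_cast
      field_simp
      ring
  have hlim : Tendsto (fun N => ∑ n ∈ Finset.range N, (u n : ℂ) * z⁻¹ ^ n) atTop (𝓝 0) := by
    have h1 : Tendsto (fun N => z⁻¹ ^ N * ((u N : ℂ) - v N)) atTop (𝓝 0) := by
      refine squeeze_zero_norm (a := fun N => ‖z⁻¹‖ ^ N * (1 + M)) (fun N => ?_) ?_
      · rw [norm_mul, norm_pow]
        gcongr
        refine (norm_sub_le _ _).trans (add_le_add ?_ (hM' N))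
        simpa using hu N
      · simpa using (tendsto_pow_atTop_nhds_zero_of_lt_one (norm_nonneg _) hw).mul_const (1 + M)
    have h2 := (h1.const_mul z).const_mul ((β : ℂ) - z)⁻¹
    simp only [mul_zero] at h2
    refine h2.congr fun N => ?_
    rw [← hsum, inv_mul_cancel_left₀ hβz]
  have hsummable : Summable fun n => (u n : ℂ) * z⁻¹ ^ n := by
    refine Summable.of_norm_bounded (summable_geometric_of_lt_one (norm_nonneg _) hw) fun n => ?_
    rw [norm_mul, norm_pow]
    exact mul_le_of_le_one_left (by positivity) (by simpa using hu n)
  refine ⟨by simpa using hw, u, ⟨hu0, fun n _ => abs_le.1 (hu n)⟩, ?_⟩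
  exact (hsummable.hasSum_iff_tendsto_nat).2 hlim

/-! ### Closedness of the right-hand side -/

theorem norm_le_one_of_mem_coeffFamily {a : ℕ → ℝ} (ha : a ∈ coeffFamily (Set.Icc (-1) 1)) (n : ℕ) :
    ‖(a n : ℂ)‖ ≤ 1 := by
  rcases Nat.eq_zero_or_pos n with rfl | h
  · simp [ha.1]
  · simpa using abs_le.2 (ha.2 n h)

theorem norm_coeff_mul_pow_le {a : ℕ → ℝ} (ha : a ∈ coeffFamily (Set.Icc (-1) 1)) {w : ℂ} {r : ℝ}
    (hw : ‖w‖ ≤ r) (n : ℕ) : ‖(a n : ℂ) * w ^ n‖ ≤ r ^ n := by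
  rw [norm_mul, norm_pow]
  calc ‖(a n : ℂ)‖ * ‖w‖ ^ n ≤ 1 * r ^ n := by
        gcongr
        exact norm_le_one_of_mem_coeffFamily ha n
    _ = r ^ n := one_mul _

theorem isCompact_coeffFamily : IsCompact (coeffFamily (Set.Icc (-1) 1)) := by
  have h : coeffFamily (Set.Icc (-1) 1) =
      Set.univ.pi fun n : ℕ => if n = 0 then ({1} : Set ℝ) else Set.Icc (-1) 1 := by
    ext a
    simp only [coeffFamily, Set.mem_ofPred_eq, Set.mem_pi, Set.mem_univ, true_imp_iff]
    constructor
    · rintro ⟨h0, h1⟩ n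
      split_ifs with hn
      · simp [hn, h0]
      · exact h1 n (by omega)
    · intro h
      refine ⟨by simpa using h 0, fun n hn => ?_⟩
      have := h n
      rwa [if_neg (by omega)] at this
  rw [h]
  refine isCompact_univ_pi fun n => ?_
  split_ifs
  · exact isCompact_singleton
  · exact isCompact_Icc

/-- The set is the projection of the pairs (series, zero), a closed subset of a compact product:
geometric domination makes the sum jointly continuous. -/
theorem isCompact_zeroSet_inter_closedBall {r : ℝ} (hr0 : 0 ≤ r) (hr : r < 1) :
    IsCompact (zeroSet (Set.Icc (-1) 1) ∩ Metric.closedBall 0 r) := by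
  set K : Set ((ℕ → ℝ) × ℂ) := coeffFamily (Set.Icc (-1) 1) ×ˢ Metric.closedBall 0 r
  have hK : IsCompact K := isCompact_coeffFamily.prod (isCompact_closedBall _ _)
  have hcont : ContinuousOn (fun p : (ℕ → ℝ) × ℂ => ∑' n : ℕ, (p.1 n : ℂ) * p.2 ^ n) K := by
    refine continuousOn_tsum (u := fun n => r ^ n) (fun n => ?_)
      (summable_geometric_of_lt_one hr0 hr) fun n p hp => ?_
    · fun_prop
    · exact norm_coeff_mul_pow_le hp.1 (by simpa using hp.2) n
  have hZ : IsCompact (K ∩ (fun p : (ℕ → ℝ) × ℂ => ∑' n : ℕ, (p.1 n : ℂ) * p.2 ^ n) ⁻¹' {0}) :=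
    hK.of_isClosed_subset (hcont.preimage_isClosed_of_isClosed hK.isClosed isClosed_singleton)
      Set.inter_subset_left
  convert hZ.image continuous_snd using 1
  ext w
  constructor
  · rintro ⟨⟨-, a, ha, hs⟩, hw⟩
    exact ⟨(a, w), ⟨⟨ha, hw⟩, hs.tsum_eq⟩, rfl⟩
  · rintro ⟨⟨a, w⟩, ⟨⟨ha, hw⟩, hs⟩, rfl⟩
    have hw' : ‖w‖ ≤ r := by simpa using hw
    refine ⟨⟨by simpa using hw'.trans_lt hr, a, ha, ?_⟩, hw⟩
    have hsum : Summable fun n => (a n : ℂ) * w ^ n :=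
      Summable.of_norm_bounded (summable_geometric_of_lt_one hr0 hr)
        fun n => norm_coeff_mul_pow_le ha hw' n
    have := hsum.hasSum
    rwa [show ∑' n, (a n : ℂ) * w ^ n = 0 from hs] at this

theorem isClosed_closedBall_union_inv_zeroSet :
    IsClosed (Metric.closedBall (0 : ℂ) 1 ∪ (zeroSet (Set.Icc (-1) 1))⁻¹) := by
  rw [← isOpen_compl_iff, isOpen_iff_mem_nhds]
  intro z hz
  simp only [Set.compl_union, Set.mem_inter_iff, Set.mem_compl_iff, Metric.mem_closedBall,
    dist_zero_right, not_le, Set.mem_inv] at hz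
  obtain ⟨hz1, hz2⟩ := hz
  have hz0 : z ≠ 0 := by rintro rfl; simp at hz1; linarith
  have hw : ‖z⁻¹‖ < 1 := by rw [norm_inv]; exact inv_lt_one_of_one_lt₀ hz1
  obtain ⟨r, hr1, hr2⟩ := exists_between hw
  have hcl := (isCompact_zeroSet_inter_closedBall ((norm_nonneg _).trans hr1.le) hr2).isClosed
  have h1 : ∀ᶠ y in 𝓝 z, y⁻¹ ∉ zeroSet (Set.Icc (-1) 1) ∩ Metric.closedBall 0 r :=
    (continuousAt_inv₀ hz0).eventually_mem (hcl.isOpen_compl.mem_nhds fun h => hz2 h.1)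
  have h2 : ∀ᶠ y in 𝓝 z, ‖y⁻¹‖ < r :=
    (continuousAt_inv₀ hz0).norm.eventually_lt_const hr1
  have h3 : ∀ᶠ y in 𝓝 z, 1 < ‖y‖ := continuous_norm.continuousAt.eventually_const_lt hz1
  filter_upwards [h1, h2, h3] with y hy1 hy2 hy3
  rintro (h | h)
  · simp at h; linarith
  · exact hy1 ⟨h, by simpa using hy2.le⟩

/-! ### Irreducibility by Eisenstein at 2 -/

theorem hornerPoly_zero (c : ℕ → ℤ) : hornerPoly c 0 = C (c 0) := rfl

theorem hornerPoly_succ (c : ℕ → ℤ) (n : ℕ) :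
    hornerPoly c (n + 1) = X * hornerPoly c n + C (c (n + 1)) := rfl

theorem monic_hornerPoly {c : ℕ → ℤ} (h0 : c 0 = 1) (n : ℕ) :
    (hornerPoly c n).Monic ∧ (hornerPoly c n).natDegree = n := by
  induction n with
  | zero => simp [hornerPoly_zero, h0]
  | succ n ih =>
    have h1 : (X * hornerPoly c n).Monic := monic_X.mul ih.1
    have h2 : (X * hornerPoly c n).natDegree = n + 1 := by
      rw [natDegree_X_mul ih.1.ne_zero, ih.2]
    have h3 : (C (c (n + 1))).degree < (X * hornerPoly c n).degree := by
      refine degree_C_le.trans_lt ?_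
      rw [← natDegree_pos_iff_degree_pos]
      omega
    rw [hornerPoly_succ]
    refine ⟨h1.add_of_left h3, ?_⟩
    rw [natDegree_add_C, h2]

theorem two_dvd_coeff_hornerPoly {c : ℕ → ℤ} (hc : ∀ n, 2 ∣ c (n + 1)) (n : ℕ) :
    ∀ i < n, 2 ∣ (hornerPoly c n).coeff i := by
  induction n with
  | zero => intro i hi; omega
  | succ n ih =>
    intro i hi
    rw [hornerPoly_succ]
    cases i with
    | zero => simpa using hc n
    | succ i =>
      rw [coeff_add, coeff_X_mul, coeff_C_succ, add_zero]
      exact ih i (by omega)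

/-- Eisenstein's criterion at `2` for Horner polynomials. -/
theorem irreducible_hornerPoly {c : ℕ → ℤ} (h0 : c 0 = 1) (hc : ∀ n, c (n + 1) % 4 = 2) (n : ℕ) :
    Irreducible (hornerPoly c (n + 1)) := by
  obtain ⟨hm, hd⟩ := monic_hornerPoly h0 (n + 1)
  have hprime : (Ideal.span {(2 : ℤ)}).IsPrime :=
    (Ideal.span_singleton_prime (by norm_num)).2 Int.prime_two
  have hE : (hornerPoly c (n + 1)).IsEisensteinAt (Ideal.span {(2 : ℤ)}) := by
    refine ⟨?_, fun {i} hi => ?_, ?_⟩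
    · rw [hm.leadingCoeff, Ideal.mem_span_singleton]
      norm_num
    · rw [Ideal.mem_span_singleton]
      exact two_dvd_coeff_hornerPoly (fun n => by have := hc n; omega) _ i (by omega)
    · rw [Ideal.span_singleton_pow, Ideal.mem_span_singleton, hornerPoly_succ]
      simp only [coeff_add, coeff_X_mul_zero, coeff_C_zero, zero_add]
      have := hc n
      omega
  exact hE.irreducible hprime hm.isPrimitive (by omega)

theorem minpoly_eq_hornerPoly {c : ℕ → ℤ} (h0 : c 0 = 1) (hc : ∀ n, c (n + 1) % 4 = 2) {m : ℕ}
    {β : ℝ} (hβ : aeval β (hornerPoly c (m + 1)) = 0) :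
    minpoly ℚ β = (hornerPoly c (m + 1)).map (algebraMap ℤ ℚ) := by
  have hm := (monic_hornerPoly h0 (m + 1)).1
  refine (minpoly.eq_of_irreducible_of_monic ?_ ?_ (hm.map _)).symm
  · exact hm.irreducible_iff_irreducible_map_fraction_map.1 (irreducible_hornerPoly h0 hc m)
  · rwa [aeval_map_algebraMap]

/-! ### Locating roots and perturbing coefficients -/

/-- If no root of `p` other than possibly `b` is within `ε` of `z`, then `p z` is large. -/
theorem exists_root_near {p : ℂ[X]} (hp : p.Monic) {b z : ℂ} (hb : p.IsRoot b) {ε : ℝ}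
    (hε : 0 < ε) (hbz : ε ≤ ‖z - b‖) (h : ‖p.eval z‖ < ‖z - b‖ * ε ^ (p.natDegree - 1)) :
    ∃ r, p.IsRoot r ∧ r ≠ b ∧ ‖z - r‖ < ε := by
  by_contra! hcon
  have hall : ∀ r ∈ p.roots, ε ≤ ‖z - r‖ := by
    intro r hr
    by_cases hrb : r = b
    · rwa [hrb]
    · exact hcon r (isRoot_of_mem_roots hr) hrb
  have hmem : b ∈ p.roots := (mem_roots hp.ne_zero).2 hb
  obtain ⟨s, hs⟩ := Multiset.exists_cons_of_mem hmem
  have hcard : Multiset.card p.roots = p.natDegree :=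
    (IsAlgClosed.splits p).natDegree_eq_card_roots.symm
  have hev : p.eval z = (z - b) * (s.map fun r => z - r).prod := by
    conv_lhs => rw [(IsAlgClosed.splits p).eq_prod_roots_of_monic hp]
    rw [hs]
    simp [eval_multiset_prod, Multiset.map_map]
  have hprod : ∀ t : Multiset ℂ, (∀ r ∈ t, ε ≤ ‖z - r‖) →
      ε ^ Multiset.card t ≤ ‖(t.map fun r => z - r).prod‖ := by
    intro t
    induction t using Multiset.induction_on with
    | empty => simp
    | cons r t ih =>
      intro ht
      have h1 := ih fun x hx => ht x (Multiset.mem_cons_of_mem hx)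
      have h2 := ht r (Multiset.mem_cons_self r t)
      simp only [Multiset.card_cons, Multiset.map_cons, Multiset.prod_cons, norm_mul, pow_succ']
      gcongr
  have h1 := hprod s fun r hr => hall r (by rw [hs]; exact Multiset.mem_cons_of_mem hr)
  have h2 : p.natDegree - 1 = Multiset.card s := by rw [← hcard, hs]; simp
  rw [hev, norm_mul, h2] at h
  exact absurd h (not_lt.2 (by gcongr))

theorem norm_horner_le {e : ℕ → ℂ} {M : ℝ} (he : ∀ n, ‖e n‖ ≤ M) (z : ℂ) (n : ℕ) :
    ‖horner e z n‖ ≤ horner (fun _ => M) ‖z‖ n := by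
  induction n with
  | zero => exact he 0
  | succ n ih =>
    rw [horner_succ, horner_succ]
    refine (norm_add_le _ _).trans (add_le_add ?_ (he _))
    rw [norm_mul]
    gcongr

/-- Multiplying by `x - B` and perturbing the coefficients. -/
theorem horner_perturb {R : Type*} [CommRing R] {a c e : ℕ → R} {B : R} (h0 : c 0 = a 0)
    (he : e 0 = 0) (h : ∀ n, c (n + 1) = a (n + 1) - B * a n + e (n + 1)) (x : R) (n : ℕ) :
    horner c x (n + 1) = (x - B) * horner a x n + a (n + 1) + horner e x (n + 1) := by
  induction n with
  | zero => simp only [horner_succ, horner_zero, h, h0, he]; ring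
  | succ n ih =>
    rw [horner_succ c, ih, horner_succ a, horner_succ e x (n + 1), h]
    ring

section RealRoot

variable {a c e : ℕ → ℝ} {B : ℝ}

theorem le_horner (h0 : a 0 = 1) (ha : ∀ n, |a n| ≤ 1) {x : ℝ} (hx : 3 ≤ x) (n : ℕ) :
    (x ^ n + 1) / 2 ≤ horner a x n := by
  induction n with
  | zero => simp [horner_zero, h0]
  | succ n ih =>
    rw [horner_succ, pow_succ']
    have := (abs_le.1 (ha (n + 1))).1
    nlinarith

theorem abs_horner_le (h0 : e 0 = 0) (he : ∀ n, |e n| ≤ 2) {x : ℝ} (hx : 3 ≤ x) (n : ℕ) :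
    |horner e x (n + 1)| ≤ 3 * x ^ n - 1 := by
  induction n with
  | zero => have := he 1; simp [horner_succ, horner_zero, h0]; linarith
  | succ n ih =>
    rw [horner_succ, pow_succ']
    have h1 := he (n + 1 + 1)
    have h2 := abs_add_le (x * horner e x (n + 1)) (e (n + 1 + 1))
    rw [abs_mul, abs_of_pos (by linarith : 0 < x)] at h2
    nlinarith

theorem continuous_horner (c : ℕ → ℝ) (n : ℕ) : Continuous fun x => horner c x n := by
  induction n with
  | zero => exact continuous_const
  | succ n ih => simp only [horner_succ]; fun_prop

/-- At x = B ± 6 the main term (x − B)A(x) has absolute value at least 3x^m + 3, beating the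
rounding error 3x^m − 1, so the sign changes. -/
theorem exists_real_root (h0 : c 0 = 1) (ha0 : a 0 = 1) (ha : ∀ n, |a n| ≤ 1) (he0 : e 0 = 0)
    (he : ∀ n, |e n| ≤ 2) (h : ∀ n, c (n + 1) = a (n + 1) - B * a n + e (n + 1)) {m : ℕ}
    (ham : a (m + 1) = 0) (hB : 9 ≤ B) :
    ∃ β ∈ Set.Icc (B - 6) (B + 6), horner c β (m + 1) = 0 := by
  have hsplit : ∀ x, horner c x (m + 1) = (x - B) * horner a x m + horner e x (m + 1) := fun x => by
    rw [horner_perturb (by rw [h0, ha0]) he0 h, ham, add_zero]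
  apply intermediate_value_Icc (by linarith) (continuous_horner c (m + 1)).continuousOn
  rw [hsplit, hsplit]
  constructor
  · have h1 := le_horner ha0 ha (x := B - 6) (by linarith) m
    have h2 := (abs_le.1 (abs_horner_le he0 he (x := B - 6) (by linarith) m)).2
    linarith
  · have h1 := le_horner ha0 ha (x := B + 6) (by linarith) m
    have h2 := (abs_le.1 (abs_horner_le he0 he (x := B + 6) (by linarith) m)).1
    linarith

/-- Run backwards from n = m + 1, where the difference vanishes, the recursion divides errors by β.
Each step adds at most 6 + 2 = 8 before division, and 8/(β − 1) is the fixed point of t ↦ (t + 8)/β.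
-/
theorem abs_horner_sub_le (ha : ∀ n, |a n| ≤ 1) (he : ∀ n, |e n| ≤ 2)
    (h : ∀ n, c (n + 1) = a (n + 1) - B * a n + e (n + 1)) {m : ℕ}
    (ham : a (m + 1) = 0) {β : ℝ} (hβ1 : 1 < β) (hβ : |β - B| ≤ 6)
    (hroot : horner c β (m + 1) = 0) :
    ∀ n ≤ m + 1, |horner c β n - a n| ≤ 8 / (β - 1) := by
  intro n hn
  induction hn using Nat.decreasingInduction with
  | self => rw [hroot, ham, sub_zero, abs_zero]; exact div_nonneg (by norm_num) (by linarith)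
  | of_succ n hn ih =>
    have h1 : β * (horner c β n - a n) =
        (horner c β (n + 1) - a (n + 1)) - (β - B) * a n - e (n + 1) := by
      rw [horner_succ, h]; ring
    have h2 : β * |horner c β n - a n| ≤ 8 / (β - 1) + 6 * 1 + 2 := by
      rw [← abs_of_pos (by linarith : 0 < β), ← abs_mul, abs_of_pos (by linarith : 0 < β), h1]
      refine (abs_sub _ _).trans (add_le_add ((abs_sub _ _).trans (add_le_add ih ?_)) (he _))
      rw [abs_mul]
      exact mul_le_mul hβ (ha n) (abs_nonneg _) (by norm_num)
    have h3 : 8 / (β - 1) + 6 * 1 + 2 = β * (8 / (β - 1)) := by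
      have : β - 1 ≠ 0 := by linarith
      field_simp
      ring
    rw [h3] at h2
    exact le_of_mul_le_mul_left h2 (by linarith)

end RealRoot

/-- The lift reaches 0, and cos 0 = 1 is fixed by the map. -/
theorem finite_forwardOrbit {β : ℝ} {c : ℕ → ℤ} (h0 : c 0 = 1) (hc : ∀ n, 2 ∣ c (n + 1)) {N : ℕ}
    (hu : ∀ n ≤ N, |horner (fun i => (c i : ℝ)) β n| ≤ 1)
    (hN : horner (fun i => (c i : ℝ)) β N = 0) :
    (forwardOrbit (genChebyshev β) (-1)).Finite := by
  choose k hk using hc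
  have horb := iterate_genChebyshev (u := fun n => horner (fun i => (c i : ℝ)) β n)
    (k := fun n => -k n) (β := β) (N := N) (by simp [horner_zero, h0]) (fun n hn => hu n hn.le)
    (fun n _ => by simp only [horner_succ, hk]; push_cast; ring)
  have hfix : ∀ n, (genChebyshev β)^[n + N] (-1) = 1 := by
    intro n
    induction n with
    | zero => rw [zero_add, horb N le_rfl, hN]; simp
    | succ n ih => rw [add_right_comm, Function.iterate_succ_apply', ih]; simp [genChebyshev]
  refine (((Set.finite_Iic N).image fun n => (genChebyshev β)^[n] (-1)).union
    (Set.finite_singleton 1)).subset ?_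
  rintro _ ⟨n, rfl⟩
  rcases le_total n N with hn | hn
  · exact Or.inl ⟨n, hn, rfl⟩
  · obtain ⟨j, rfl⟩ := Nat.exists_eq_add_of_le' hn
    exact Or.inr (hfix j)

/-! ### Approximating small-coefficient roots by conjugates -/

/-- Zeros of monic real polynomials whose other coefficients have absolute value less than `1`. -/
def smallCoeffRoots : Set ℂ :=
  {z | ∃ (m : ℕ) (a : ℕ → ℝ) (δ : ℝ), 0 < δ ∧ a 0 = 1 ∧ (∀ n, 1 ≤ n → |a n| ≤ 1 - δ) ∧
    (∀ n, m < n → a n = 0) ∧ horner (fun n => (a n : ℂ)) z m = 0}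

/-- The leading coefficient `1` followed by a rounding of `q` to integers congruent to `2`
modulo `4`. -/
noncomputable def roundedCoeffs (q : ℕ → ℝ) : ℕ → ℤ
  | 0 => 1
  | n + 1 => 4 * ⌊q n / 4⌋ + 2

theorem abs_roundedCoeffs_sub_le (q : ℕ → ℝ) (n : ℕ) :
    |(roundedCoeffs q (n + 1) : ℝ) - q n| ≤ 2 := by
  have h1 := Int.floor_le (q n / 4)
  have h2 := Int.lt_floor_add_one (q n / 4)
  simp only [roundedCoeffs]
  push_cast
  rw [abs_le]
  constructor <;> linarith

theorem smallCoeffRoots_subset : smallCoeffRoots ⊆ closure {z : ℂ | ∃ β : ℝ, 1 < β ∧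
    (forwardOrbit (genChebyshev β) (-1)).Finite ∧ z ∈ galoisConjugates β} := by
  rintro z ⟨m, a, δ, hδ, ha0, ha, ham, hz⟩
  rw [Metric.mem_closure_iff]
  intro ε hε
  have hδ1 : δ ≤ 1 := by have := ha 1 le_rfl; linarith [abs_nonneg (a 1)]
  have ha1 : ∀ n, |a n| ≤ 1 := by
    intro n
    rcases Nat.eq_zero_or_pos n with rfl | h
    · simp [ha0]
    · linarith [ha n h]
  set M : ℝ := horner (fun _ => 2) ‖z‖ (m + 1) with hM
  -- The root β is at least B − 6. The term 8/δ keeps the Horner values within δ of `a`; ‖z‖ + ε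
  -- keeps β away from z; |M|/ε^m makes |z − β| ε^m exceed the bound M for |p(z)|, forcing a second
  -- root near z.
  set B : ℝ := 10 + 8 / δ + ‖z‖ + ε + |M| / ε ^ m with hB
  have hp1 : 0 < 8 / δ := by positivity
  have hp2 : 0 ≤ |M| / ε ^ m := by positivity
  have hp3 := norm_nonneg z
  set q : ℕ → ℝ := fun n => a (n + 1) - B * a n with hq
  set c : ℕ → ℤ := roundedCoeffs q with hcdef
  have hc0 : c 0 = 1 := rfl
  have hc4 : ∀ n, c (n + 1) % 4 = 2 := fun n => by
    have : c (n + 1) = 4 * ⌊q n / 4⌋ + 2 := rfl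
    omega
  obtain ⟨e, he0, he, hce⟩ : ∃ e : ℕ → ℝ, e 0 = 0 ∧ (∀ n, |e n| ≤ 2) ∧
      ∀ n, (c (n + 1) : ℝ) = a (n + 1) - B * a n + e (n + 1) := by
    refine ⟨fun n => Nat.casesOn n 0 fun j => (c (j + 1) : ℝ) - q j, rfl, ?_, fun n => ?_⟩
    · rintro (_ | n)
      · simp
      · exact abs_roundedCoeffs_sub_le q n
    · simp only [hq]; ring
  obtain ⟨β, hβB, hroot⟩ := exists_real_root (c := fun n => (c n : ℝ)) (by simp [hc0]) ha0 ha1 he0 he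
    hce (ham (m + 1) (by omega)) (by linarith)
  have hβ1 : 1 < β := by linarith [hβB.1]
  have hβδ : 8 / (β - 1) ≤ δ := by
    rw [div_le_iff₀ (by linarith), mul_comm, ← div_le_iff₀ hδ]
    linarith [hβB.1]
  have hclose := abs_horner_sub_le (c := fun n => (c n : ℝ)) ha1 he hce (ham (m + 1) (by omega)) hβ1
    (by rw [abs_le]; constructor <;> linarith [hβB.1, hβB.2]) hroot
  have hfin : (forwardOrbit (genChebyshev β) (-1)).Finite := by
    refine finite_forwardOrbit (c := c) hc0 (fun n => by have := hc4 n; omega) (N := m + 1)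
      (fun n hn => ?_) hroot
    rcases Nat.eq_zero_or_pos n with rfl | h
    · simp [horner_zero, hc0]
    · have h1 := hclose n hn
      have h2 := ha n h
      have h3 := abs_sub_abs_le_abs_sub (horner (fun i => (c i : ℝ)) β n) (a n)
      linarith
  have hmin := minpoly_eq_hornerPoly hc0 hc4 (m := m) (β := β) (by rw [aeval_hornerPoly]; exact hroot)
  obtain ⟨hmonic, hdeg⟩ := monic_hornerPoly hc0 (m + 1)
  set p : ℂ[X] := (hornerPoly c (m + 1)).map (algebraMap ℤ ℂ) with hp
  have hpev : ∀ x : ℂ, p.eval x = horner (fun n => (c n : ℂ)) x (m + 1) := fun x => by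
    rw [hp, eval_map_algebraMap, aeval_hornerPoly]
  have hpdeg : p.natDegree = m + 1 := by rw [hp, hmonic.natDegree_map, hdeg]
  have hpz : ‖p.eval z‖ ≤ M := by
    have h1 := horner_perturb (R := ℂ) (a := fun n => (a n : ℂ)) (c := fun n => (c n : ℂ))
      (e := fun n => (e n : ℂ)) (B := (B : ℂ)) (by simp [hc0, ha0]) (by simp [he0])
      (fun n => by rw [← Complex.ofReal_intCast, hce]; push_cast; rfl) z m
    rw [hpev, h1, hz, ham (m + 1) (by omega)]
    simp only [mul_zero, Complex.ofReal_zero, zero_add]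
    exact norm_horner_le (fun n => by simpa using he n) z (m + 1)
  have hβroot : p.IsRoot (β : ℂ) := by
    have h1 := map_horner Complex.ofRealHom (fun n => (c n : ℝ)) β (m + 1)
    rw [hroot] at h1
    rw [IsRoot, hpev]
    simpa using h1.symm
  have hfar : B - 6 - ‖z‖ ≤ ‖z - β‖ := by
    have h1 := norm_sub_norm_le (β : ℂ) z
    rw [norm_sub_rev] at h1
    have h2 : ‖(β : ℂ)‖ = β := by simp; linarith
    linarith [hβB.1]
  obtain ⟨r, hr, hrβ, hrz⟩ := exists_root_near (hmonic.map _) hβroot hε (z := z) (by linarith) (by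
    rw [hpdeg, Nat.add_sub_cancel]
    refine hpz.trans_lt ((le_abs_self M).trans_lt ?_)
    rw [← div_lt_iff₀ (by positivity)]
    linarith)
  refine ⟨r, ⟨β, hβ1, hfin, ?_, hrβ⟩, by rwa [dist_eq_norm]⟩
  rw [hmin]
  refine mem_rootSet.2 ⟨(hmonic.map _).ne_zero, ?_⟩
  rw [aeval_map_algebraMap, ← eval_map_algebraMap]
  exact hr

/-! ### The open unit disk -/

theorem exists_small_relation {z : ℂ} (hz : ‖z‖ < 1) :
    ∃ (k : ℕ) (α γ : ℝ), |α| ≤ 1 / 2 ∧ |γ| ≤ 1 / 2 ∧ z ^ (k + 2) + α * z + γ = 0 := by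
  -- For nonreal z these are the coordinates of −z^(k+2) in the real basis z, 1, and they tend to 0
  -- with z^(k+2). For real z, division by zero gives α = 0, and γ = −z^(k+2) still works.
  let α : ℕ → ℝ := fun k => -((z ^ (k + 2)).im / z.im)
  let γ : ℕ → ℝ := fun k => -(z ^ (k + 2)).re - α k * z.re
  have hpow : Tendsto (fun k : ℕ => z ^ (k + 2)) atTop (𝓝 0) :=
    (tendsto_pow_atTop_nhds_zero_of_norm_lt_one hz).comp (tendsto_add_atTop_nat 2)
  have him : Tendsto (fun k : ℕ => (z ^ (k + 2)).im) atTop (𝓝 0) := by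
    simpa [Function.comp_def] using (Complex.continuous_im.tendsto 0).comp hpow
  have hre : Tendsto (fun k : ℕ => (z ^ (k + 2)).re) atTop (𝓝 0) := by
    simpa [Function.comp_def] using (Complex.continuous_re.tendsto 0).comp hpow
  have hα : Tendsto α atTop (𝓝 0) := by simpa [α] using (him.div_const z.im).neg
  have hγ : Tendsto γ atTop (𝓝 0) := by simpa [γ] using hre.neg.sub (hα.mul_const z.re)
  have h1 : ∀ᶠ k in atTop, |α k| ≤ 1 / 2 := by
    have := hα.abs.eventually_lt_const (show |(0 : ℝ)| < 1 / 2 by norm_num)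
    exact this.mono fun k hk => hk.le
  have h2 : ∀ᶠ k in atTop, |γ k| ≤ 1 / 2 := by
    have := hγ.abs.eventually_lt_const (show |(0 : ℝ)| < 1 / 2 by norm_num)
    exact this.mono fun k hk => hk.le
  obtain ⟨k, hk1, hk2⟩ := (h1.and h2).exists
  refine ⟨k, α k, γ k, hk1, hk2, ?_⟩
  apply Complex.ext
  · simp [γ]
  · by_cases h0 : z.im = 0
    · have hzre : z = (z.re : ℂ) := Complex.ext (by simp) (by simp [h0])
      have : (z ^ (k + 2)).im = 0 := by rw [hzre, ← Complex.ofReal_pow, Complex.ofReal_im]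
      simp [h0, this]
    · simp [α]
      field_simp
      ring

theorem ball_subset_smallCoeffRoots : Metric.ball (0 : ℂ) 1 ⊆ smallCoeffRoots := by
  intro z hz
  obtain ⟨k, α, γ, hα, hγ, hrel⟩ := exists_small_relation (by simpa using hz)
  let a : ℕ → ℝ := fun n => if n = 0 then 1 else if n = k + 1 then α else if n = k + 2 then γ else 0
  refine ⟨k + 2, a, 1 / 2, by norm_num, rfl, fun n hn => ?_, fun n hn => ?_, ?_⟩
  · simp only [a]
    split_ifs
    · omega
    · linarith
    · linarith
    · norm_num
  · simp only [a]
    rw [if_neg (by omega), if_neg (by omega), if_neg (by omega)]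
  · have h1 : ∀ n ≤ k, horner (fun n => (a n : ℂ)) z n = z ^ n := by
      intro n hn
      induction n with
      | zero => simp [horner_zero, a]
      | succ n ih =>
        rw [horner_succ, ih (by omega), pow_succ']
        simp only [a]
        rw [if_neg (by omega), if_neg (by omega), if_neg (by omega)]
        simp
    rw [horner_succ, horner_succ, h1 k le_rfl]
    have h2 : a (k + 1) = α := by simp [a]
    have h3 : a (k + 1 + 1) = γ := by simp [a]
    rw [h2, h3, ← hrel]
    ring

/-! ### Inverses of power series zeros -/

/-- The partial sums of a power series near a zero of it attain all small values. -/
theorem exists_partialSum_eq {a : ℕ → ℝ} (ha : a ∈ coeffFamily (Set.Icc (-1) 1)) {w : ℂ}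
    (hw : ‖w‖ < 1) (hs : HasSum (fun n : ℕ => (a n : ℂ) * w ^ n) 0) {ε : ℝ} (hε : 0 < ε) :
    ∃ μ > 0, ∃ N : ℕ, ∀ y : ℂ, ‖y‖ < μ →
      ∃ x : ℂ, ‖x - w‖ < ε ∧ ∑ n ∈ Finset.range (N + 1), (a n : ℂ) * x ^ n = y := by
  set f : ℂ → ℂ := fun x => ∑' n : ℕ, (a n : ℂ) * x ^ n with hf
  have hdiff : ∀ r : ℝ, 0 ≤ r → r < 1 → DifferentiableOn ℂ f (Metric.ball 0 r) := fun r hr0 hr => by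
    refine Complex.differentiableOn_tsum_of_summable_norm (summable_geometric_of_lt_one hr0 hr)
      (fun n => by fun_prop) Metric.isOpen_ball fun n x hx => ?_
    exact norm_coeff_mul_pow_le ha (by simpa using (mem_ball_zero_iff.1 hx).le) n
  have hdiff1 : DifferentiableOn ℂ f (Metric.ball 0 1) := by
    intro x hx
    obtain ⟨r, hr1, hr2⟩ := exists_between (mem_ball_zero_iff.1 hx)
    exact ((hdiff r ((norm_nonneg _).trans hr1.le) hr2).differentiableAt
      (Metric.isOpen_ball.mem_nhds (mem_ball_zero_iff.2 hr1))).differentiableWithinAt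
  have han : AnalyticOnNhd ℂ f (Metric.ball 0 1) := hdiff1.analyticOnNhd Metric.isOpen_ball
  have hf0 : f 0 = 1 := by
    rw [hf]
    dsimp only
    rw [tsum_eq_single 0 fun n hn => by simp [hn]]
    simp [ha.1]
  have hfw : f w = 0 := hs.tsum_eq
  have hwmem : w ∈ Metric.ball (0 : ℂ) 1 := mem_ball_zero_iff.2 hw
  -- The zero w is isolated, since f(0) = 1 excludes f ≡ 0.
  have hne : ∀ᶠ x in 𝓝[≠] w, f x ≠ 0 := by
    rcases (han w hwmem).eventually_eq_zero_or_eventually_ne_zero with h | h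
    · have := han.eqOn_zero_of_preconnected_of_eventuallyEq_zero
        (convex_ball (0 : ℂ) 1).isPreconnected hwmem h (Metric.mem_ball_self one_pos)
      rw [hf0] at this
      simp at this
    · exact h
  rw [eventually_nhdsWithin_iff, Metric.eventually_nhds_iff] at hne
  obtain ⟨ρ, hρ, hρne⟩ := hne
  set t : ℝ := min (ρ / 2) (min (ε / 2) ((1 - ‖w‖) / 2)) with ht
  have ht0 : 0 < t := lt_min (by linarith) (lt_min (by linarith) (by linarith))
  have ht1 : t ≤ ρ / 2 := min_le_left _ _
  have ht2 : t ≤ ε / 2 := (min_le_right _ _).trans (min_le_left _ _)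
  have ht3 : t ≤ (1 - ‖w‖) / 2 := (min_le_right _ _).trans (min_le_right _ _)
  set r : ℝ := ‖w‖ + t with hr
  have hr0 : 0 ≤ r := by positivity
  have hr1 : r < 1 := by linarith
  have hball : ∀ x ∈ Metric.closedBall w t, ‖x‖ ≤ r := fun x hx => by
    rw [Metric.mem_closedBall, dist_eq_norm] at hx
    linarith [norm_sub_norm_le x w]
  have hcontf : ContinuousOn f (Metric.sphere w t) := hdiff1.continuousOn.mono fun x hx =>
    mem_ball_zero_iff.2 ((hball x (Metric.sphere_subset_closedBall hx)).trans_lt hr1)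
  obtain ⟨x₀, hx₀, hmin⟩ := (isCompact_sphere w t).exists_isMinOn
    (NormedSpace.sphere_nonempty.2 ht0.le) hcontf.norm
  have hν : 0 < ‖f x₀‖ := by
    rw [norm_pos_iff]
    have h1 : dist x₀ w = t := hx₀
    exact hρne (by linarith) fun h => by
      rw [Set.mem_singleton_iff.1 h, dist_self] at h1
      linarith
  set ν : ℝ := ‖f x₀‖ with hνdef
  have hunif : TendstoUniformlyOn (fun N x => ∑ n ∈ Finset.range N, (a n : ℂ) * x ^ n) f atTop
      (Metric.closedBall w t) :=
    tendstoUniformlyOn_tsum_nat (summable_geometric_of_lt_one hr0 hr1)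
      fun n x hx => norm_coeff_mul_pow_le ha (hball x hx) n
  obtain ⟨N, hN⟩ := ((tendsto_add_atTop_nat 1).eventually
    (Metric.tendstoUniformlyOn_iff.1 hunif (ν / 8) (by positivity))).exists
  set s : ℂ → ℂ := fun x => ∑ n ∈ Finset.range (N + 1), (a n : ℂ) * x ^ n with hsdef
  have hclose : ∀ x ∈ Metric.closedBall w t, ‖f x - s x‖ < ν / 8 := fun x hx => by
    rw [← dist_eq_norm]
    exact hN x hx
  have hsw : ‖s w‖ < ν / 8 := by
    have := hclose w (Metric.mem_closedBall_self ht0.le)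
    rwa [hfw, zero_sub, norm_neg] at this
  have hsph : ∀ x ∈ Metric.sphere w t, ν / 2 ≤ ‖s x - s w‖ := fun x hx => by
    have h1 := hclose x (Metric.sphere_subset_closedBall hx)
    have h2 : ν ≤ ‖f x‖ := hmin hx
    have h3 := norm_sub_norm_le (f x) (s x)
    have h4 := norm_sub_norm_le (s x) (s w)
    linarith
  have hsdiff : Differentiable ℂ s := by
    rw [hsdef]
    fun_prop
  have hfreq : ∃ᶠ x in 𝓝 w, s x ≠ s w := by
    intro hev
    have hsan : AnalyticOnNhd ℂ s Set.univ := hsdiff.differentiableOn.analyticOnNhd isOpen_univ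
    have hev' : s =ᶠ[𝓝 w] fun _ => s w := hev.mono fun x hx => not_not.1 hx
    have h1 := hsan.eqOn_of_preconnected_of_eventuallyEq (fun x _ => analyticAt_const)
      isPreconnected_univ (Set.mem_univ w) hev' (Set.mem_univ x₀)
    have h2 := hsph x₀ hx₀
    rw [h1, sub_self, norm_zero] at h2
    linarith
  -- Quantitative open mapping: |s − s(w)| ≥ ν/2 on the circle puts the ball of radius ν/4 about
  -- s(w) in the image. As |s(w)| < ν/8, it contains every y with |y| < ν/8.
  refine ⟨ν / 8, by positivity, N, fun y hy => ?_⟩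
  have hy' : y ∈ Metric.ball (s w) (ν / 2 / 2) := by
    rw [Metric.mem_ball, dist_eq_norm]
    have := norm_sub_le y (s w)
    linarith
  obtain ⟨x, hx, hxy⟩ := hsdiff.diffContOnCl.ball_subset_image_closedBall ht0 hsph hfreq hy'
  refine ⟨x, ?_, hxy⟩
  rw [Metric.mem_closedBall, dist_eq_norm] at hx
  linarith

theorem horner_eq_pow_mul_sum {K : Type*} [Field K] (c : ℕ → K) {z : K} (hz : z ≠ 0) (n : ℕ) :
    horner c z n = z ^ n * ∑ i ∈ Finset.range (n + 1), c i * z⁻¹ ^ i := by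
  induction n with
  | zero => simp [horner_zero]
  | succ n ih =>
    rw [horner_succ, ih, Finset.sum_range_succ _ (n + 1), mul_add, mul_left_comm _ (c _),
      ← mul_pow, mul_inv_cancel₀ hz, pow_succ]
    ring

theorem inv_zeroSet_subset_closure_smallCoeffRoots :
    (zeroSet (Set.Icc (-1) 1))⁻¹ ⊆ closure smallCoeffRoots := by
  rintro z ⟨hzb, a, ha, hs⟩
  have hw : ‖z⁻¹‖ < 1 := mem_ball_zero_iff.1 hzb
  have hw0 : z⁻¹ ≠ 0 := by
    intro h
    rw [h] at hs
    have h1 : HasSum (fun n : ℕ => (a n : ℂ) * (0 : ℂ) ^ n) ((a 0 : ℂ) * 0 ^ 0) :=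
      hasSum_single 0 fun n hn => by simp [hn]
    have := hs.unique h1
    simp [ha.1] at this
  rw [Metric.mem_closure_iff]
  intro ε hε
  have hcont : ContinuousAt (fun x : ℂ => x⁻¹) z⁻¹ := continuousAt_inv₀ hw0
  have hev : ∀ᶠ x in 𝓝 z⁻¹, dist x⁻¹ z⁻¹⁻¹ < ε ∧ x ≠ 0 :=
    (Metric.tendsto_nhds.1 hcont ε hε).and (isOpen_ne.mem_nhds hw0)
  obtain ⟨ε', hε', hball⟩ := Metric.eventually_nhds_iff.1 hev
  obtain ⟨μ, hμ, N, hN⟩ := exists_partialSum_eq ha hw hs hε'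
  -- Aiming at −μ/2 instead of 0 raises the constant term to 1 + μ/2; dividing by it makes the other
  -- coefficients uniformly smaller than 1, as `smallCoeffRoots` requires.
  obtain ⟨x, hx, hsum⟩ := hN (-(μ / 2 : ℝ)) (by
    rw [norm_neg, Complex.norm_real, Real.norm_eq_abs, abs_of_pos (by linarith)]
    linarith)
  obtain ⟨hxε, hx0⟩ := hball (by rwa [dist_eq_norm] : dist x z⁻¹ < ε')
  refine ⟨x⁻¹, ?_, by rwa [inv_inv, dist_comm] at hxε⟩
  have hη : 0 < 1 + μ / 2 := by linarith
  let b : ℕ → ℝ := fun n => if n = 0 then 1 else if n ≤ N then a n / (1 + μ / 2) else 0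
  refine ⟨N, b, 1 - 1 / (1 + μ / 2), ?_, rfl, fun n hn => ?_, fun n hn => ?_, ?_⟩
  · rw [sub_pos, div_lt_one hη]
    linarith
  · simp only [b]
    rw [if_neg (by omega), sub_sub_cancel]
    split_ifs
    · rw [abs_div, abs_of_pos hη]
      gcongr
      exact abs_le.2 (ha.2 n hn)
    · rw [abs_zero]
      positivity
  · simp only [b]
    rw [if_neg (by omega), if_neg (by omega)]
  · have hη' : (1 + (μ : ℂ) / 2) ≠ 0 := by exact_mod_cast hη.ne'
    rw [horner_eq_pow_mul_sum _ (inv_ne_zero hx0), inv_inv]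
    have h1 : (1 + (μ : ℂ) / 2) * ∑ i ∈ Finset.range (N + 1), (b i : ℂ) * x ^ i =
        μ / 2 + ∑ i ∈ Finset.range (N + 1), (a i : ℂ) * x ^ i := by
      rw [Finset.sum_range_succ', Finset.sum_range_succ', mul_add, Finset.mul_sum]
      have h2 : ∀ i ∈ Finset.range N, (1 + (μ : ℂ) / 2) * ((b (i + 1) : ℂ) * x ^ (i + 1)) =
          (a (i + 1) : ℂ) * x ^ (i + 1) := fun i hi => by
        have : b (i + 1) = a (i + 1) / (1 + μ / 2) := by
          simp only [b]
          rw [if_neg (by omega), if_pos (by have := Finset.mem_range.1 hi; omega)]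
        rw [this]
        push_cast
        rw [← mul_assoc, mul_div_cancel₀ _ hη']
      rw [Finset.sum_congr rfl h2]
      simp [b, ha.1]
      ring
    rw [hsum] at h1
    have h3 : (1 + (μ : ℂ) / 2) * ∑ i ∈ Finset.range (N + 1), (b i : ℂ) * x ^ i = 0 := by
      rw [h1]
      push_cast
      ring
    rw [(mul_eq_zero.1 h3).resolve_left hη', mul_zero]

theorem corollary2p6 :
    closure {z : ℂ | ∃ β : ℝ, 1 < β ∧
        (forwardOrbit (genChebyshev β) (-1)).Finite ∧ z ∈ galoisConjugates β} =
      closure (Metric.ball (0 : ℂ) 1) ∪ (zeroSet (Set.Icc (-1) 1))⁻¹ := by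
  apply subset_antisymm
  · rw [closure_ball _ one_ne_zero]
    refine closure_minimal ?_ isClosed_closedBall_union_inv_zeroSet
    rintro z ⟨β, -, hfin, hz⟩
    rcases le_or_gt ‖z‖ 1 with h | h
    · exact Or.inl (mem_closedBall_zero_iff.2 h)
    · exact Or.inr (inv_mem_zeroSet_of_mem_galoisConjugates hfin hz h)
  · have h := closure_minimal smallCoeffRoots_subset isClosed_closure
    exact Set.union_subset ((closure_mono ball_subset_smallCoeffRoots).trans h)
      (inv_zeroSet_subset_closure_smallCoeffRoots.trans h)
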